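/- A $3$-graph $G$ consists of a finite vertex set $V(G)$ and a set $E(G)$ of $3$-element subsets of $V(G)$. Its Lagrangian is $$\lambda(G)=\max\Big\{\sum_{e\in E(G)}\prod_{i\in e}x_i \;:\; x\in[0,1]^{V(G)},\ \sum_{i\in V(G)}x_i=1\Big\}$$ (and $\lambda(G)=0$ if $V(G)=\emptyset$). For $3$-graphs $F$ and $G$, we say that $G$ contains $F$ (as a subgraph, up to isomorphism) if there is an injection $V(F)\to V(G)$ that maps every edge of $F$ to an edge of $G$, and that $G$ is $F$-free otherwise. Let $C_3^3$ be the linear triangle, with vertex set $\{1,\dots,6\}$ and edges $\{1,2,3\},\{3,4,5\},\{5,6,1\}$, and let $K_5^3$ be the complete $3$-graph on $5$ vertices. Let $G$ be a $C_3^3$-free $3$-graph. Then $$\lambda(G)\le\lambda(K_5^3)=\frac{2}{25},$$ and $\lambda(G)=\lambda(K_5^3)$ holds if and only if $G$ contains $K_5^3$ as a subgraph. -/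

import Mathlib

/-- An `r`-uniform graph (`r`-graph) with vertex set `V`: a family of `r`-element subsets of `V`. -/
structure UniformGraph (r : ℕ) (V : Type*) where
  edges : Finset (Finset V)
  card_eq : ∀ e ∈ edges, e.card = r

namespace UniformGraph

/-- `G` contains a copy of `F`: some injection of the vertices maps every edge of `F`
to an edge of `G`. -/
def Contains {r : ℕ} {V W : Type*} (G : UniformGraph r V) (F : UniformGraph r W) : Prop :=
  ∃ f : W ↪ V, ∀ e ∈ F.edges, e.map f ∈ G.edges

/-- `G` is `F`-free. -/
def Free {r : ℕ} {V W : Type*} (G : UniformGraph r V) (F : UniformGraph r W) : Prop :=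
  ¬ G.Contains F

/-- The Lagrangian function `λ(G, x) = ∑_{e ∈ E(G)} ∏_{i ∈ e} x_i`. -/
def lagrangianFun {r : ℕ} {V : Type*} (G : UniformGraph r V) (x : V → ℝ) : ℝ :=
  ∑ e ∈ G.edges, ∏ i ∈ e, x i

/-- The Lagrangian `λ(G)`: the maximum of `λ(G, x)` over the standard simplex. It is attained when
`V` is nonempty (`isGreatest_lagrangian`); for the graph without vertices it is `0`. -/
noncomputable def lagrangian {r : ℕ} {V : Type*} [Fintype V] (G : UniformGraph r V) : ℝ :=
  sSup (G.lagrangianFun '' stdSimplex ℝ V)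

theorem isGreatest_lagrangian {r : ℕ} {V : Type*} [Fintype V] [Nonempty V]
    (G : UniformGraph r V) :
    IsGreatest (G.lagrangianFun '' stdSimplex ℝ V) G.lagrangian := by
  classical
  have hc : Continuous G.lagrangianFun := by
    unfold lagrangianFun
    fun_prop
  have hne : (stdSimplex ℝ V).Nonempty :=
    ⟨_, single_mem_stdSimplex ℝ (Classical.arbitrary V)⟩
  exact ((isCompact_stdSimplex ℝ V).image hc).isGreatest_sSup (hne.image _)

/-- The complete `r`-graph `K_t^r` on `t` vertices. -/
def complete (r t : ℕ) : UniformGraph r (Fin t) where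
  edges := Finset.powersetCard r Finset.univ
  card_eq := fun _ he => (Finset.mem_powersetCard.mp he).2

/-- The linear triangle `C_3^3 = {123, 345, 561}`, with the vertices `1, …, 6` renamed
`0, …, 5`. -/
def linearTriangle : UniformGraph 3 (Fin 6) where
  edges := {{0, 1, 2}, {2, 3, 4}, {4, 5, 0}}
  card_eq := by decide

end UniformGraph

/-! Take an optimal weighting of smallest support. Shifting weight between two vertices shows that
any two support vertices lie in a common edge inside the support, and that all links there have the
same weight `6 * G.lagrangian` (`exists_optimal`). If the Lagrangian is at least 2/25, every such
link weighs at least 12/25.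

On six or more vertices this is impossible (`exists_linkWeight_lt`). If at most three vertices of
the link of `a` have degree above one, each edge of the link can be charged to one of its ends,
every vertex being charged at most once; the link then weighs at most `2 * m * (1 - x a)`, where `m`
bounds the weights of the other ends. For `m = x a` this clashes with the trivial bound `(1 - x a) ^
2`. Covering of pairs and triangle-freeness force any other link to be a block `D` plus isolated
edges (`card_rich_le_or_isBlock`). Such a block is rigid: either `D ∪ {a}` is everything and the
links of vertices of `D` are stars at `a`, or the charging works for the heaviest vertex outside `D
∪ {a}`.

On at most five vertices, comparison with the sum over all triples gives 2/25, with equality only if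
there are five vertices and every triple is an edge. -/

/-! ### Structure of links when all pairs are covered -/

/-- A symmetric irreflexive ternary relation without linear triangles in which every pair of
vertices is covered. -/
structure CoveringTriangleFree {W : Type*} (T : W → W → W → Prop) : Prop where
  swap₁₂ : ∀ {a b c}, T a b c → T b a c
  swap₂₃ : ∀ {a b c}, T a b c → T a c b
  ne : ∀ {a b c}, T a b c → a ≠ b
  cover : ∀ {a b}, a ≠ b → ∃ c, T a b c
  free : ∀ {a b c x y z}, T a b x → T b c y → T c a z → x ≠ c → y ≠ a → z ≠ b →
    x ≠ y → y ≠ z → z ≠ x → False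

/-- The vertex `v` has at least two neighbours in the link of `a`. -/
def Rich {W : Type*} (T : W → W → W → Prop) (a v : W) : Prop :=
  ∃ f g, f ≠ g ∧ T a v f ∧ T a v g

/-- The link of `a` consists of a part `D` with at least four vertices, in which every vertex has
at least two neighbours, and of isolated edges. -/
structure IsBlock {W : Type*} (T : W → W → W → Prop) (a : W) (D : Finset W) : Prop where
  notMem : a ∉ D
  card : 4 ≤ D.card
  rich : ∀ v ∈ D, ∃ f ∈ D, ∃ g ∈ D, f ≠ g ∧ T a v f ∧ T a v g
  outside : ∀ z, z ≠ a → z ∉ D → ∃ z', z' ∉ D ∧ T a z z' ∧ ∀ w, T a z w → w = z'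
  clique : D.card = 4 ∨ ∀ u ∈ D, ∀ v ∈ D, u ≠ v → T a u v

namespace CoveringTriangleFree

variable {W : Type*} {T : W → W → W → Prop} (h : CoveringTriangleFree T)
include h

theorem ne₁₃ {a b c : W} (hT : T a b c) : a ≠ c := h.ne (h.swap₂₃ hT)

theorem ne₂₃ {a b c : W} (hT : T a b c) : b ≠ c := h.ne₁₃ (h.swap₁₂ hT)

/-- If `z` is a leaf at `z'` in the link of `a` and `v` has two neighbours other than `z'` there,
then the only edge through `v` and `z` is `v z z'`. -/
theorem eq_of_leaf {a z z' v f g w : W} (hz : T a z z') (hl : ∀ w, T a z w → w = z')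
    (hv' : v ≠ z') (hfg : f ≠ g) (hf : T a v f) (hg : T a v g) (hf' : f ≠ z')
    (hg' : g ≠ z') (hw : T v z w) : w = z' := by
  by_contra hne
  have hvz : ¬ T a v z := fun hT => hv' (hl _ (h.swap₂₃ hT))
  have hwa : w ≠ a := by
    rintro rfl
    exact hvz (h.swap₁₂ (h.swap₂₃ hw))
  -- Otherwise `a v k`, `v z w`, `z a z'` form a linear triangle. So `w` would be the only neighbour
  -- of `v` besides `z'`.
  have key : ∀ k, T a v k → k ≠ z' → k = w := by
    intro k hk hkz
    by_contra hkw
    refine h.free hk hw (h.swap₁₂ hz) ?_ hwa hv'.symm hkw hne hkz.symm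
    rintro rfl
    exact hvz hk
  exact hfg ((key f hf hf').trans (key g hg hg').symm)

/-- Two nonadjacent vertices with at least two neighbours in a link have the same two
neighbours there. -/
theorem twins {a u v : W} (hu : Rich T a u) (hv : Rich T a v) (huv : u ≠ v) (hn : ¬ T a u v) :
    ∃ d e, d ≠ e ∧ T u v d ∧ (∀ k, T a u k ↔ k = d ∨ k = e) ∧
      (∀ k, T a v k ↔ k = d ∨ k = e) := by
  obtain ⟨d, hd⟩ := h.cover huv
  have hda : d ≠ a := by
    rintro rfl
    exact hn (h.swap₁₂ (h.swap₂₃ hd))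
  -- Otherwise `a u f`, `u v d`, `v a g` form a linear triangle. Hence, apart from `d`, both
  -- neighbourhoods are the same single vertex.
  have key : ∀ f g, T a u f → T a v g → f ≠ d → g ≠ d → f = g := by
    intro f g hf hg hfd hgd
    by_contra hne
    refine h.free hf hd (h.swap₁₂ hg) ?_ hda ?_ hfd hgd.symm (Ne.symm hne)
    · rintro rfl; exact hn hf
    · rintro rfl; exact hn (h.swap₂₃ hg)
  obtain ⟨f₁, f₂, hf, hf₁, hf₂⟩ := hu
  obtain ⟨g₁, g₂, hg, hg₁, hg₂⟩ := hv
  obtain ⟨e, he, hed⟩ : ∃ e, T a u e ∧ e ≠ d := by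
    by_cases hc : f₁ = d
    · exact ⟨f₂, hf₂, fun h' => hf (hc.trans h'.symm)⟩
    · exact ⟨f₁, hf₁, hc⟩
  obtain ⟨e', he', hed'⟩ : ∃ e, T a v e ∧ e ≠ d := by
    by_cases hc : g₁ = d
    · exact ⟨g₂, hg₂, fun h' => hg (hc.trans h'.symm)⟩
    · exact ⟨g₁, hg₁, hc⟩
  have hee : e = e' := key e e' he he' hed hed'
  subst hee
  have hu' : ∀ k, T a u k → k = d ∨ k = e := fun k hk => by
    by_cases hc : k = d
    · exact Or.inl hc
    · exact Or.inr (key k e hk he' hc hed)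
  have hv' : ∀ k, T a v k → k = d ∨ k = e := fun k hk => by
    by_cases hc : k = d
    · exact Or.inl hc
    · exact Or.inr (key e k he hk hed hc).symm
  refine ⟨d, e, hed.symm, hd, fun k => ⟨hu' k, ?_⟩, fun k => ⟨hv' k, ?_⟩⟩
  · rintro (rfl | rfl)
    · rcases hu' _ hf₁ with rfl | rfl
      · exact hf₁
      · rcases hu' _ hf₂ with rfl | rfl
        · exact hf₂
        · exact absurd rfl hf
    · exact he
  · rintro (rfl | rfl)
    · rcases hv' _ hg₁ with rfl | rfl
      · exact hg₁
      · rcases hv' _ hg₂ with rfl | rfl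
        · exact hg₂
        · exact absurd rfl hg
    · exact he'

theorem isBlock_of_twins [DecidableEq W] {a x y d e : W} (hax : a ≠ x) (hay : a ≠ y)
    (hxy : x ≠ y) (hn : ¬ T a x y) (hde : d ≠ e) (hd : T x y d)
    (hx : ∀ k, T a x k ↔ k = d ∨ k = e) (hy : ∀ k, T a y k ↔ k = d ∨ k = e) :
    IsBlock T a {x, y, d, e} := by
  have hxd : T a x d := (hx d).2 (Or.inl rfl)
  have hxe : T a x e := (hx e).2 (Or.inr rfl)
  have hyd : T a y d := (hy d).2 (Or.inl rfl)
  have hye : T a y e := (hy e).2 (Or.inr rfl)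
  have n1 := h.ne₁₃ hxd
  have n2 := h.ne₂₃ hxd
  have n3 := h.ne₁₃ hxe
  have n4 := h.ne₂₃ hxe
  have n5 := h.ne₂₃ hyd
  have n6 := h.ne₂₃ hye
  -- Otherwise `a x e`, `x d y`, `d a z` form a linear triangle.
  have hadz : ∀ z, z ≠ x → z ≠ y → z ≠ e → ¬ T a d z := fun z z1 z2 z4 hz =>
    h.free hxe (h.swap₂₃ hd) (h.swap₁₂ hz) hde.symm hay.symm
      z1 n6.symm z2.symm z4
  -- Unlike `d`, the vertex `e` is not known to lie in an edge with `x` and `y`. The edge covering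
  -- `x z` turns out to be `x z e`, and then `x y d`, `y e a`, `e x z` form a linear triangle.
  have haez : ∀ z, z ≠ a → z ≠ x → z ≠ y → z ≠ d → z ≠ e → ¬ T a e z := by
    intro z z0 z1 z2 z3 z4 hz
    have hxz : ¬ T a x z := fun hT => by
      rcases (hx z).1 hT with rfl | rfl
      · exact z3 rfl
      · exact z4 rfl
    obtain ⟨w, hw⟩ := h.cover z1.symm
    have hwa : w ≠ a := by
      rintro rfl
      exact hxz (h.swap₁₂ (h.swap₂₃ hw))
    have hwd : w ≠ d := by
      rintro rfl
      exact h.free hxe (h.swap₂₃ hw) (h.swap₁₂ (h.swap₂₃ hyd)) hde.symm z0 hxy.symm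
        z4.symm z2 n6
    have hwe : w = e := by
      by_contra hwe
      exact h.free hxd hw (h.swap₁₂ (h.swap₂₃ hz)) z3.symm hwa n4.symm hwd.symm hwe hde.symm
    subst hwe
    exact h.free hd (h.swap₁₂ hye |> h.swap₂₃) (h.swap₁₂ (h.swap₂₃ hw)) hde hax z2 n1.symm
      z0.symm z3
  have hcard : ({x, y, d, e} : Finset W).card = 4 := by
    rw [Finset.card_insert_of_notMem, Finset.card_insert_of_notMem,
      Finset.card_insert_of_notMem, Finset.card_singleton] <;> simp [*]
  refine ⟨?_, hcard.ge, ?_, ?_, Or.inl hcard⟩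
  · simp [hax, hay, n1, n3]
  · intro v hv
    simp only [Finset.mem_insert, Finset.mem_singleton] at hv
    rcases hv with rfl | rfl | rfl | rfl
    · exact ⟨d, by simp, e, by simp, hde, hxd, hxe⟩
    · exact ⟨d, by simp, e, by simp, hde, hyd, hye⟩
    · exact ⟨x, by simp, y, by simp, hxy, h.swap₂₃ hxd, h.swap₂₃ hyd⟩
    · exact ⟨x, by simp, y, by simp, hxy, h.swap₂₃ hxe, h.swap₂₃ hye⟩
  · intro z z0 hz
    simp only [Finset.mem_insert, Finset.mem_singleton, not_or] at hz ⊢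
    obtain ⟨z1, z2, z3, z4⟩ := hz
    have hxz : ¬ T a x z := fun hT => by
      rcases (hx z).1 hT with rfl | rfl
      · exact z3 rfl
      · exact z4 rfl
    have hyz : ¬ T a y z := fun hT => by
      rcases (hy z).1 hT with rfl | rfl
      · exact z3 rfl
      · exact z4 rfl
    have out : ∀ w, T a z w → w ≠ x ∧ w ≠ y ∧ w ≠ d ∧ w ≠ e := by
      intro w hw
      refine ⟨?_, ?_, ?_, ?_⟩ <;> rintro rfl
      · exact hxz (h.swap₂₃ hw)
      · exact hyz (h.swap₂₃ hw)
      · exact hadz z z1 z2 z4 (h.swap₂₃ hw)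
      · exact haez z z0 z1 z2 z3 z4 (h.swap₂₃ hw)
    obtain ⟨z', hz'⟩ := h.cover z0.symm
    refine ⟨z', by simpa using out z' hz', hz', fun w hw => ?_⟩
    by_contra hne
    -- A second neighbour would make `z` a twin of `x`, hence adjacent to `d`.
    obtain ⟨d', e', -, -, hx', hz''⟩ :=
      h.twins ⟨d, e, hde, hxd, hxe⟩ ⟨w, z', hne, hw, hz'⟩ (Ne.symm z1) hxz
    exact (out d ((hz'' d).2 ((hx' d).1 hxd))).2.2.1 rfl

/-- A link has at most three vertices of degree at least two, or it is a block with isolated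
edges. -/
theorem card_rich_le_or_isBlock [Fintype W] [DecidableEq W] [∀ a, DecidablePred (Rich T a)]
    (a : W) :
    (Finset.univ.filter (Rich T a)).card ≤ 3 ∨ ∃ D, IsBlock T a D := by
  by_cases htw : ∃ x y, Rich T a x ∧ Rich T a y ∧ x ≠ y ∧ ¬ T a x y
  · obtain ⟨x, y, hx, hy, hxy, hn⟩ := htw
    obtain ⟨d, e, hde, hd, hx', hy'⟩ := h.twins hx hy hxy hn
    obtain ⟨f, -, -, hf, -⟩ := hx
    obtain ⟨g, -, -, hg, -⟩ := hy
    exact Or.inr ⟨_, h.isBlock_of_twins (h.ne hf) (h.ne hg) hxy hn hde hd hx' hy'⟩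
  push Not at htw
  by_cases hc : (Finset.univ.filter (Rich T a)).card ≤ 3
  · exact Or.inl hc
  push Not at hc
  set D := Finset.univ.filter (Rich T a) with hD
  have hmem : ∀ v, v ∈ D ↔ Rich T a v := fun v => by simp [hD]
  have hcl : ∀ u ∈ D, ∀ v ∈ D, u ≠ v → T a u v := fun u hu v hv huv =>
    htw u v ((hmem u).1 hu) ((hmem v).1 hv) huv
  have three : ∀ v ∈ D, ∃ f ∈ D, ∃ g ∈ D, ∃ k ∈ D, f ≠ g ∧ f ≠ k ∧ g ≠ k ∧ v ≠ f ∧ v ≠ g ∧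
      v ≠ k := by
    intro v hv
    have : 2 < (D.erase v).card := by
      rw [Finset.card_erase_of_mem hv]; omega
    obtain ⟨f, g, k, hf, hg, hk, h1, h2, h3⟩ := Finset.two_lt_card_iff.1 this
    rw [Finset.mem_erase] at hf hg hk
    exact ⟨f, hf.2, g, hg.2, k, hk.2, h1, h2, h3, hf.1.symm, hg.1.symm, hk.1.symm⟩
  refine Or.inr ⟨D, ⟨?_, hc, ?_, ?_, Or.inr hcl⟩⟩
  · intro ha
    obtain ⟨f, -, -, hf, -⟩ := (hmem a).1 ha
    exact h.ne hf rfl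
  · intro v hv
    obtain ⟨f, hf, g, hg, -, -, hfg, -, -, hvf, hvg, -⟩ := three v hv
    exact ⟨f, hf, g, hg, hfg, hcl v hv f hf hvf, hcl v hv g hg hvg⟩
  · intro z hza hz
    obtain ⟨z', hz'⟩ := h.cover hza.symm
    have hl : ∀ w, T a z w → w = z' := fun w hw => by
      by_contra hne
      exact hz ((hmem z).2 ⟨w, z', hne, hw, hz'⟩)
    refine ⟨z', fun hd => ?_, hz', hl⟩
    -- If `z'` were in `D`, covering `p z` would force the edge `p z z'`, and `a p q`, `p z' z`, `z'
    -- a r` would form a linear triangle.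
    obtain ⟨p, hp, q, hq, r, hr, hpq, hpr, hqr, h1, h2, h3⟩ := three z' hd
    obtain ⟨w, hw⟩ := h.cover (show p ≠ z by rintro rfl; exact hz hp)
    have hwz := h.eq_of_leaf hz' hl h1.symm hqr (hcl p hp q hq hpq) (hcl p hp r hr hpr)
      h2.symm h3.symm hw
    subst hwz
    have hqz : q ≠ z := by rintro rfl; exact hz hq
    have hrz : r ≠ z := by rintro rfl; exact hz hr
    exact h.free (hcl p hp q hq hpq) (h.swap₂₃ hw) (h.swap₁₂ (hcl w hd r hr h3)) h2.symm hza
      hpr.symm hqz hrz.symm hqr.symm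

/-- Outside a block, every vertex `z` has a partner `z'` through which all edges joining `z` to the
block pass. -/
theorem IsBlock.partner {a : W} {D : Finset W} (hD : IsBlock T a D) {z : W} (hza : z ≠ a)
    (hz : z ∉ D) : ∃ z', z' ≠ a ∧ z' ∉ D ∧ z' ≠ z ∧
      ∀ v, v = a ∨ v ∈ D → T z v z' ∧ ∀ w, T z v w → w = z' := by
  obtain ⟨z', hz'D, hz', hl⟩ := hD.outside z hza hz
  refine ⟨z', (h.ne₁₃ hz').symm, hz'D, (h.ne₂₃ hz').symm, ?_⟩
  rintro v (rfl | hv)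
  · exact ⟨h.swap₁₂ hz', fun w hw => hl w (h.swap₁₂ hw)⟩
  · obtain ⟨f, hf, g, hg, hfg, hvf, hvg⟩ := hD.rich v hv
    have key : ∀ w, T z v w → w = z' := fun w hw =>
      h.eq_of_leaf hz' hl (by rintro rfl; exact hz'D hv) hfg hvf hvg
        (by rintro rfl; exact hz'D hf) (by rintro rfl; exact hz'D hg) (h.swap₁₂ hw)
    obtain ⟨w, hw⟩ := h.cover (show z ≠ v by rintro rfl; exact hz hv)
    have := key w hw
    subst this
    exact ⟨hw, key⟩

/-- In the link of `z`, the vertex `a` is a leaf at the partner `z'`. In a block structure at `z`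
this would make `a z'` an isolated edge, but `z'` is also adjacent there to all of `D`. -/
theorem IsBlock.not_isBlock {a : W} {D : Finset W} (hD : IsBlock T a D) {z : W} (hza : z ≠ a)
    (hz : z ∉ D) (D' : Finset W) : ¬ IsBlock T z D' := by
  intro hD'
  obtain ⟨z', hz'a, hz'D, hz'z, hp⟩ := IsBlock.partner h hD hza hz
  have haD' : a ∉ D' := by
    intro ha
    obtain ⟨f, -, g, -, hfg, hf, hg⟩ := hD'.rich a ha
    exact hfg (((hp a (Or.inl rfl)).2 f hf).trans ((hp a (Or.inl rfl)).2 g hg).symm)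
  obtain ⟨y, hyD, hy, hl⟩ := hD'.outside a hza.symm haD'
  have hy' := (hp a (Or.inl rfl)).2 y hy
  subst hy'
  obtain ⟨y, -, hy', hl'⟩ := hD'.outside _ hz'z hyD
  obtain ⟨v, hv⟩ : D.Nonempty := Finset.card_pos.1 (by have := hD.card; omega)
  have e1 := hl' a (h.swap₂₃ hy)
  have e2 := hl' v (h.swap₂₃ (hp v (Or.inr hv)).1)
  exact hD.notMem (by rw [e1, ← e2]; exact hv)

/-- If the block is everything else, all edges pass through `a`. -/
theorem IsBlock.star [DecidableEq W] {a : W} {D : Finset W} (hD : IsBlock T a D)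
    (hall : ∀ z, z = a ∨ z ∈ D) (hcard : 5 ≤ D.card) {x y w : W} (hx : x ∈ D) (hy : y ∈ D)
    (hT : T x y w) : w = a := by
  by_contra hw
  have hwD := (hall w).resolve_left hw
  have hcl : ∀ u ∈ D, ∀ v ∈ D, u ≠ v → T a u v := hD.clique.resolve_left (by omega)
  have hxy := h.ne hT
  -- Beyond four vertices a block is a clique and has two vertices `f`, `g` besides `x`, `y`, `w`;
  -- then `a x f`, `x y w`, `y a g` form a linear triangle.
  have : 1 < (((D.erase x).erase y).erase w).card := by
    rw [Finset.card_erase_of_mem, Finset.card_erase_of_mem, Finset.card_erase_of_mem hx]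
    · omega
    · simp [hy, hxy.symm]
    · simp [hwD, (h.ne₁₃ hT).symm, (h.ne₂₃ hT).symm]
  obtain ⟨f, hf, g, hg, hfg⟩ := Finset.one_lt_card.1 this
  simp only [Finset.mem_erase] at hf hg
  exact h.free (hcl x hx f hf.2.2.2 hf.2.2.1.symm) hT (h.swap₁₂ (hcl y hy g hg.2.2.2 hg.2.1.symm))
    hf.2.1 hw hg.2.2.1 hf.1 hg.1.symm hfg.symm

end CoveringTriangleFree

/-! ### Weight bounds for links -/

/-- On a set with at most three elements there is a self-map along which any two distinct elements
are joined. -/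
theorem Finset.exists_cyclic_map {α : Type*} [DecidableEq α] {D : Finset α} (hD : D.card ≤ 3) :
    ∃ σ : α → α, (∀ p ∈ D, σ p ∈ D) ∧ ∀ p ∈ D, ∀ q ∈ D, p ≠ q → σ p = q ∨ σ q = p := by
  have : D.card = 0 ∨ D.card = 1 ∨ D.card = 2 ∨ D.card = 3 := by omega
  rcases this with h | h | h | h
  · rw [Finset.card_eq_zero] at h
    subst h
    exact ⟨id, by simp⟩
  · obtain ⟨a, rfl⟩ := Finset.card_eq_one.1 h
    exact ⟨id, by simp⟩
  · obtain ⟨a, b, hab, rfl⟩ := Finset.card_eq_two.1 h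
    exact ⟨fun p => if p = a then b else a, by grind, by grind⟩
  · obtain ⟨a, b, c, hab, hac, hbc, rfl⟩ := Finset.card_eq_three.1 h
    exact ⟨fun p => if p = a then b else if p = b then c else a, by grind, by grind⟩

/-- On `m < 2 / 5` the value of `2 * m * (1 - m)` stays below 12/25, and for `m ≥ 2 / 5` the square
is at most 9/25. -/
theorem no_weight_of_link_bounds {m L L' : ℝ} (h0 : 0 ≤ m) (h1 : m ≤ 1) (hL : 12 / 25 ≤ L)
    (hLm : L ≤ 2 * m * (1 - m)) (hL' : 12 / 25 ≤ L') (hLm' : L' ≤ (1 - m) ^ 2) : False := by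
  have : 2 / 5 ≤ m := by
    by_contra hm
    push Not at hm
    nlinarith
  nlinarith

theorem sum_ite_eq_zero_else {α : Type*} [Fintype α] [DecidableEq α] {x : α → ℝ}
    (hsum : ∑ v, x v = 1) (a : α) : ∑ v, (if v = a then 0 else x v) = 1 - x a := by
  rw [← hsum, eq_sub_iff_add_eq, ← Finset.sum_erase_add _ _ (Finset.mem_univ a),
    ← Finset.sum_erase_add _ x (Finset.mem_univ a)]
  simp only [if_true, add_zero]
  congr 1
  exact Finset.sum_congr rfl fun v hv => if_neg (Finset.ne_of_mem_erase hv)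

namespace CoveringTriangleFree

open Classical in
/-- The weight of the link of `a`, each edge being counted twice. -/
noncomputable def linkWeight {W : Type*} [Fintype W] (T : W → W → W → Prop) (x : W → ℝ)
    (a : W) : ℝ :=
  ∑ b, ∑ c, if T a b c then x b * x c else 0

/-- If every edge of the link of `a` has the form `{b, f b}` with `b ≠ r` and `f b` of weight at
most `m`, the link is light. -/
theorem linkWeight_le_of_charge {W : Type*} [Fintype W] {T : W → W → W → Prop} {x : W → ℝ}
    (hx : ∀ v, 0 ≤ x v) (hsum : ∑ v, x v = 1) (a r : W) {m : ℝ}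
    (f : W → W) (hf : ∀ b c, T a b c → b ≠ r ∧ f b = c ∨ c ≠ r ∧ f c = b)
    (hm : ∀ b, b ≠ r → x (f b) ≤ m) :
    linkWeight T x a ≤ 2 * m * (1 - x r) := by
  classical
  have hs := sum_ite_eq_zero_else hsum r
  set g : W → ℝ := fun v => if v = r then 0 else x v with hg
  have hg0 : ∀ v, 0 ≤ g v := fun v => by
    simp only [hg]; split_ifs <;> [exact le_rfl; exact hx v]
  have key : linkWeight T x a ≤
      ∑ b, ∑ c, ((if f b = c then g b * x c else 0) + if f c = b then g c * x b else 0) := by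
    refine Finset.sum_le_sum fun b _ => Finset.sum_le_sum fun c _ => ?_
    have h1 : 0 ≤ g b * x c := mul_nonneg (hg0 b) (hx c)
    have h2 : 0 ≤ g c * x b := mul_nonneg (hg0 c) (hx b)
    by_cases hT : T a b c
    · rw [if_pos hT]
      rcases hf b c hT with ⟨hb, hfb⟩ | ⟨hc, hfc⟩
      · rw [if_pos hfb, show g b = x b from if_neg hb]
        split_ifs <;> linarith
      · rw [if_pos hfc, show g c = x c from if_neg hc, mul_comm (x c)]
        split_ifs <;> linarith
    · rw [if_neg hT]
      split_ifs <;> linarith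
  have e1 : ∑ b, ∑ c, (if f b = c then g b * x c else 0) = ∑ b, g b * x (f b) := by simp
  have e2 : ∑ b, ∑ c, (if f c = b then g c * x b else 0) = ∑ b, g b * x (f b) := by
    rw [Finset.sum_comm]; simp
  simp only [Finset.sum_add_distrib] at key
  rw [e1, e2] at key
  have : ∑ b, g b * x (f b) ≤ ∑ b, g b * m := by
    refine Finset.sum_le_sum fun b _ => ?_
    by_cases hb : b = r
    · simp [hg, hb]
    · exact mul_le_mul_of_nonneg_left (hm b hb) (hg0 b)
  rw [← Finset.sum_mul, hs] at this
  linarith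

variable {W : Type*} {T : W → W → W → Prop} (h : CoveringTriangleFree T)
  [Fintype W] {x : W → ℝ}
include h

theorem linkWeight_le_sq (hx : ∀ v, 0 ≤ x v) (hsum : ∑ v, x v = 1) (a : W) :
    linkWeight T x a ≤ (1 - x a) ^ 2 := by
  classical
  have hs := sum_ite_eq_zero_else hsum a
  rw [← hs, sq, Finset.sum_mul_sum]
  refine Finset.sum_le_sum fun b _ => Finset.sum_le_sum fun c _ => ?_
  have hb := hx b
  have hc := hx c
  split_ifs with h1 h2 h3 h4 h5
  · exact absurd h2.symm (h.ne h1)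
  · exact absurd h2.symm (h.ne h1)
  · exact absurd h4.symm (h.ne₁₃ h1)
  · exact le_rfl
  all_goals positivity

/-- By covering, every vertex other than `a` that is not rich has exactly one edge in the link, and
pays for it. The at most three rich vertices pay for the edges among themselves along a cyclic map.
-/
theorem linkWeight_le_of_card_rich_le [DecidableEq W] [∀ a, DecidablePred (Rich T a)]
    (hx : ∀ v, 0 ≤ x v)
    (hsum : ∑ v, x v = 1) {a : W} {m : ℝ} (hcard : (Finset.univ.filter (Rich T a)).card ≤ 3)
    (hrich : ∀ v, Rich T a v → x v ≤ m) (hleaf : ∀ p q, T a p q → ¬ Rich T a p → x q ≤ m) :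
    linkWeight T x a ≤ 2 * m * (1 - x a) := by
  obtain ⟨σ, hσ, hσ'⟩ := Finset.exists_cyclic_map hcard
  simp only [Finset.mem_filter, Finset.mem_univ, true_and] at hσ hσ'
  have hc : ∀ b, ∃ c, a ≠ b → T a b c := fun b => by
    by_cases hb : a = b
    · exact ⟨a, fun h' => absurd hb h'⟩
    · obtain ⟨c, hc⟩ := h.cover hb
      exact ⟨c, fun _ => hc⟩
  choose l hl using hc
  have leaf : ∀ b c, T a b c → ¬ Rich T a b → l b = c := fun b c hT hb => by
    by_contra hne
    exact hb ⟨l b, c, hne, hl b (h.ne hT), hT⟩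
  refine linkWeight_le_of_charge hx hsum a a (fun b => if Rich T a b then σ b else l b) ?_ ?_
  · intro b c hT
    by_cases hb : Rich T a b
    · by_cases hc : Rich T a c
      · simpa [hb, hc, (h.ne hT).symm, (h.ne₁₃ hT).symm] using hσ' b hb c hc (h.ne₂₃ hT)
      · right
        simpa [hc, (h.ne₁₃ hT).symm] using leaf c b (h.swap₂₃ hT) hc
    · left
      simpa [hb, (h.ne hT).symm] using leaf b c hT hb
  · intro b hb
    by_cases hr : Rich T a b
    · simpa [hr] using hrich _ (hσ b hr)
    · simpa [hr] using hleaf b _ (hl b (Ne.symm hb)) hr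

/-- On at least six vertices, no weighting has all links as heavy as those of `K_5^3`. -/
theorem exists_linkWeight_lt (hcard : 6 ≤ Fintype.card W) (hx : ∀ v, 0 ≤ x v)
    (hsum : ∑ v, x v = 1) : ∃ a, linkWeight T x a < 12 / 25 := by
  classical
  by_contra! hk
  have hx1 : ∀ v, x v ≤ 1 := fun v => by
    rw [← hsum]
    exact Finset.single_le_sum (fun i _ => hx i) (Finset.mem_univ v)
  by_cases hbig : ∃ a D, IsBlock T a D
  · obtain ⟨a, D, hD⟩ := hbig
    by_cases hall : ∀ z, z = a ∨ z ∈ D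
    · have huniv : (Finset.univ : Finset W) = insert a D := by
        ext z; simpa using hall z
      have hD5 : 5 ≤ D.card := by
        rw [← Finset.card_univ, huniv, Finset.card_insert_of_notMem hD.notMem] at hcard
        omega
      obtain ⟨p, hp⟩ : D.Nonempty := Finset.card_pos.1 (by omega)
      have hpa : p ≠ a := by rintro rfl; exact hD.notMem hp
      -- Two links are played off against each other: that of `p` is a star centred at `a`, that of
      -- `a` avoids `a`.
      refine no_weight_of_link_bounds (hx a) (hx1 a) (hk p) ?_ (hk a)
        (h.linkWeight_le_sq hx hsum a)
      refine linkWeight_le_of_charge hx hsum p a (fun _ => a) ?_ fun _ _ => le_rfl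
      intro b c hT
      rcases hall b with rfl | hb
      · exact Or.inr ⟨(h.ne₂₃ hT).symm, rfl⟩
      · have hc := IsBlock.star h hD hall hD5 hp hb hT
        exact Or.inl ⟨by rintro rfl; exact hD.notMem hb, hc.symm⟩
    · push Not at hall
      have hne : (Finset.univ.filter fun z => z ≠ a ∧ z ∉ D).Nonempty := by
        obtain ⟨z, hz⟩ := hall
        exact ⟨z, by simpa using hz⟩
      -- In the link of the heaviest outside vertex `z`, rich vertices and neighbours of leaves all
      -- lie outside `D ∪ {a}`, so they weigh at most `x z`.
      obtain ⟨z, hz, hmax⟩ := Finset.exists_max_image _ x hne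
      simp only [Finset.mem_filter, Finset.mem_univ, true_and] at hz hmax
      obtain ⟨z', hz'a, hz'D, hz'z, hp⟩ := IsBlock.partner h hD hz.1 hz.2
      refine no_weight_of_link_bounds (hx z) (hx1 z) (hk z) ?_ (hk z)
        (h.linkWeight_le_sq hx hsum z)
      have hpoor : ∀ v, v = a ∨ v ∈ D → ¬ Rich T z v := by
        rintro v hv ⟨f, g, hfg, hf, hg⟩
        exact hfg (((hp v hv).2 f hf).trans ((hp v hv).2 g hg).symm)
      have hz'r : Rich T z z' := by
        obtain ⟨v, hv⟩ : D.Nonempty := Finset.card_pos.1 (by have := hD.card; omega)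
        exact ⟨a, v, by rintro rfl; exact hD.notMem hv, h.swap₂₃ (hp a (Or.inl rfl)).1,
          h.swap₂₃ (hp v (Or.inr hv)).1⟩
      refine h.linkWeight_le_of_card_rich_le hx hsum ?_ ?_ ?_
      · exact (h.card_rich_le_or_isBlock z).resolve_right
          fun ⟨D', hD'⟩ => IsBlock.not_isBlock h hD hz.1 hz.2 D' hD'
      · intro v hv
        refine hmax v ⟨?_, ?_⟩
        · exact fun hva => hpoor v (Or.inl hva) hv
        · exact fun hvD => hpoor v (Or.inr hvD) hv
      · intro p q hpq hpr
        have : ¬ (q = a ∨ q ∈ D) := fun hq => by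
          have := (hp q hq).2 p (h.swap₂₃ hpq)
          exact hpr (this ▸ hz'r)
        push Not at this
        exact hmax q this
  · have : Nonempty W := Fintype.card_pos_iff.1 (by omega)
    obtain ⟨a, -, hmax⟩ := Finset.exists_max_image Finset.univ x Finset.univ_nonempty
    refine no_weight_of_link_bounds (hx a) (hx1 a) (hk a) ?_ (hk a)
      (h.linkWeight_le_sq hx hsum a)
    exact h.linkWeight_le_of_card_rich_le hx hsum
      ((h.card_rich_le_or_isBlock a).resolve_right fun hD => hbig ⟨a, hD⟩)
      (fun v _ => hmax v (Finset.mem_univ v)) fun _ q _ _ => hmax q (Finset.mem_univ q)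

end CoveringTriangleFree

/-! ### Shifting weight in a symmetric trilinear form -/

/-- The trilinear form with coefficients `τ`. -/
def trilinearForm {V : Type*} [Fintype V] (τ : V → V → V → ℝ) (x y z : V → ℝ) : ℝ :=
  ∑ a, ∑ b, ∑ c, τ a b c * (x a * y b * z c)

section TrilinearForm

variable {V : Type*} [Fintype V] {τ : V → V → V → ℝ}

theorem trilinearForm_swap₁₂ (h₁₂ : ∀ a b c, τ a b c = τ b a c) (x y z : V → ℝ) :
    trilinearForm τ x y z = trilinearForm τ y x z := by
  unfold trilinearForm
  rw [Finset.sum_comm]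
  refine Finset.sum_congr rfl fun a _ => Finset.sum_congr rfl fun b _ =>
    Finset.sum_congr rfl fun c _ => ?_
  rw [h₁₂ b a, mul_comm (x b)]

theorem trilinearForm_swap₂₃ (h₂₃ : ∀ a b c, τ a b c = τ a c b) (x y z : V → ℝ) :
    trilinearForm τ x y z = trilinearForm τ x z y := by
  unfold trilinearForm
  refine Finset.sum_congr rfl fun a _ => ?_
  rw [Finset.sum_comm]
  refine Finset.sum_congr rfl fun b _ => Finset.sum_congr rfl fun c _ => ?_
  rw [h₂₃ a c b, mul_right_comm]

theorem trilinearForm_add_smul (x x' y z : V → ℝ) (t : ℝ) :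
    trilinearForm τ (x + t • x') y z = trilinearForm τ x y z + t * trilinearForm τ x' y z := by
  simp only [trilinearForm, Finset.mul_sum, ← Finset.sum_add_distrib, Pi.add_apply, Pi.smul_apply,
    smul_eq_mul]
  refine Finset.sum_congr rfl fun a _ => Finset.sum_congr rfl fun b _ =>
    Finset.sum_congr rfl fun c _ => ?_
  ring

theorem trilinearForm_single [DecidableEq V] (i : V) (y z : V → ℝ) :
    trilinearForm τ (Pi.single i 1) y z = ∑ b, ∑ c, τ i b c * (y b * z c) := by
  unfold trilinearForm
  rw [Finset.sum_eq_single i]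
  · simp
  · intro a _ ha
    simp [Pi.single_eq_of_ne ha]
  · simp

theorem trilinearForm_single_single [DecidableEq V] (i j : V) (z : V → ℝ) :
    trilinearForm τ (Pi.single i 1) (Pi.single j 1) z = ∑ c, τ i j c * z c := by
  rw [trilinearForm_single, Finset.sum_eq_single j]
  · simp
  · intro a _ ha
    simp [Pi.single_eq_of_ne ha]
  · simp

/-- The effect of moving weight `t` from `j` to `i`. -/
theorem trilinearForm_shift [DecidableEq V] (h₁₂ : ∀ a b c, τ a b c = τ b a c)
    (h₂₃ : ∀ a b c, τ a b c = τ a c b) (h₀ : ∀ a c, τ a a c = 0) (x : V → ℝ) (i j : V) (t : ℝ) :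
    trilinearForm τ (x + t • (Pi.single i 1 - Pi.single j 1))
        (x + t • (Pi.single i 1 - Pi.single j 1)) (x + t • (Pi.single i 1 - Pi.single j 1)) =
      trilinearForm τ x x x
        + 3 * t * ((∑ b, ∑ c, τ i b c * (x b * x c)) - ∑ b, ∑ c, τ j b c * (x b * x c))
        - 6 * t ^ 2 * ∑ c, τ i j c * x c := by
  set d : V → ℝ := Pi.single i 1 - Pi.single j 1 with hd
  have s₁ := trilinearForm_swap₁₂ h₁₂
  have s₂ := trilinearForm_swap₂₃ h₂₃
  have ad := @trilinearForm_add_smul V _ τ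
  have hdl : ∀ y z, trilinearForm τ d y z = trilinearForm τ (Pi.single i 1) y z
      - trilinearForm τ (Pi.single j 1) y z := by
    intro y z
    have := ad (Pi.single i 1) (Pi.single j 1) y z (-1)
    rw [show (Pi.single i 1 + (-1 : ℝ) • Pi.single j 1 : V → ℝ) = d by
      rw [hd, neg_one_smul, sub_eq_add_neg]] at this
    rw [this]; ring
  have hdd : ∀ z, trilinearForm τ d d z = -2 * ∑ c, τ i j c * z c := by
    intro z
    rw [hdl, s₁ (Pi.single i 1) d, s₁ (Pi.single j 1) d, hdl, hdl]
    simp only [trilinearForm_single_single, h₀, h₁₂ j i]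
    simp
    ring
  -- The cubic term only sees triples from `{i, j}`, which repeat a vertex.
  have hddd : trilinearForm τ d d d = 0 := by
    rw [hdd, hd]
    have e1 : τ i j i = 0 := by rw [h₂₃, h₀]
    have e2 : τ i j j = 0 := by rw [h₁₂, h₂₃, h₀]
    simp [mul_sub, Finset.sum_sub_distrib, Pi.single_apply, e1, e2]
  have h1 : trilinearForm τ d x x =
      (∑ b, ∑ c, τ i b c * (x b * x c)) - ∑ b, ∑ c, τ j b c * (x b * x c) := by
    rw [hdl, trilinearForm_single, trilinearForm_single]
  rw [ad, s₁ x, s₁ d (x + t • d), ad, ad, s₂ x x, s₂ d x, s₂ x d, s₂ d d, s₁ x (x + t • d),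
    s₁ d (x + t • d), ad, ad, s₁ x (x + t • d), s₁ d (x + t • d), ad, ad, s₂ x d x, s₁ x d d,
    s₂ d x d, hddd, hdd, h1, s₂ x x d, s₁ x d x, h1]
  ring

end TrilinearForm

/-! ### The Lagrangian as a trilinear form -/

namespace UniformGraph

variable {V : Type*}

open Classical in
/-- The ternary edge relation of a `3`-graph. -/
def Edge (G : UniformGraph 3 V) (a b c : V) : Prop := {a, b, c} ∈ G.edges

open Classical in
theorem edge_iff (G : UniformGraph 3 V) {a b c : V} : G.Edge a b c ↔ {a, b, c} ∈ G.edges := Iff.rfl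

variable {G : UniformGraph 3 V}

theorem Edge.swap₁₂ {a b c : V} (h : G.Edge a b c) : G.Edge b a c := by
  classical
  have : ({b, a, c} : Finset V) = {a, b, c} := by grind
  rw [edge_iff] at *
  convert h using 1

theorem Edge.swap₂₃ {a b c : V} (h : G.Edge a b c) : G.Edge a c b := by
  classical
  have : ({a, c, b} : Finset V) = {a, b, c} := by grind
  rw [edge_iff] at *
  convert h using 1

theorem Edge.ne {a b c : V} (h : G.Edge a b c) : a ≠ b := by
  classical
  rintro rfl
  have h3 := G.card_eq _ h
  rw [Finset.insert_idem] at h3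
  have := Finset.card_le_two (a := a) (b := c)
  omega

theorem sum_triples_eq [Fintype V] [DecidableEq V] (x : V → ℝ) {e : Finset V} (he : e.card = 3) :
    ∑ a, ∑ b, ∑ c, (if {a, b, c} = e then x a * x b * x c else 0) = 6 * ∏ i ∈ e, x i := by
  obtain ⟨p, q, r, hpq, hpr, hqr, rfl⟩ := Finset.card_eq_three.1 he
  have hset : (Finset.univ.filter fun t : V × V × V => ({t.1, t.2.1, t.2.2} : Finset V) = {p, q, r})
      = {(p, q, r), (p, r, q), (q, p, r), (q, r, p), (r, p, q), (r, q, p)} := by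
    ext ⟨a, b, c⟩
    simp only [Finset.mem_filter, Finset.mem_univ, true_and, Finset.mem_insert,
      Finset.mem_singleton, Prod.mk.injEq]
    constructor
    · intro h
      have h1 : ∀ v, (v = a ∨ v = b ∨ v = c) ↔ (v = p ∨ v = q ∨ v = r) := fun v => by
        simpa using Finset.ext_iff.1 h v
      have := h1 a
      have := h1 b
      have := h1 c
      have := h1 p
      have := h1 q
      have := h1 r
      clear h h1 he
      grind
    · grind
  have : ∑ a, ∑ b, ∑ c, (if {a, b, c} = ({p, q, r} : Finset V) then x a * x b * x c else 0) =
      ∑ t : V × V × V, if ({t.1, t.2.1, t.2.2} : Finset V) = {p, q, r} then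
        x t.1 * x t.2.1 * x t.2.2 else 0 := by
    simp only [Fintype.sum_prod_type]
  rw [this, ← Finset.sum_filter, hset]
  rw [Finset.sum_insert, Finset.sum_insert, Finset.sum_insert, Finset.sum_insert,
    Finset.sum_insert, Finset.sum_singleton, Finset.prod_insert, Finset.prod_insert,
    Finset.prod_singleton]
  · ring
  all_goals simp [hpq, hpr, hqr, hpq.symm, hpr.symm, hqr.symm]

open Classical in
/-- The indicator of the edge relation. -/
noncomputable def edgeCoeff (G : UniformGraph 3 V) (a b c : V) : ℝ := if G.Edge a b c then 1 else 0

theorem six_mul_lagrangianFun [Fintype V] (G : UniformGraph 3 V) (x : V → ℝ) :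
    6 * G.lagrangianFun x = trilinearForm G.edgeCoeff x x x := by
  classical
  unfold lagrangianFun
  rw [Finset.mul_sum, Finset.sum_congr rfl fun e he => (sum_triples_eq x (G.card_eq e he)).symm]
  rw [Finset.sum_comm]
  refine Finset.sum_congr rfl fun a _ => ?_
  rw [Finset.sum_comm]
  refine Finset.sum_congr rfl fun b _ => ?_
  rw [Finset.sum_comm]
  refine Finset.sum_congr rfl fun c _ => ?_
  rw [Finset.sum_ite_eq, edgeCoeff, edge_iff, ite_mul, one_mul, zero_mul]
  congr!

end UniformGraph

namespace UniformGraph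

variable {V : Type*} {G : UniformGraph 3 V}

theorem Edge.ne₁₃ {a b c : V} (h : G.Edge a b c) : a ≠ c := h.swap₂₃.ne

theorem Edge.ne₂₃ {a b c : V} (h : G.Edge a b c) : b ≠ c := h.swap₁₂.ne₁₃

theorem edgeCoeff_swap₁₂ (a b c : V) : G.edgeCoeff a b c = G.edgeCoeff b a c := by
  unfold edgeCoeff
  rw [show G.Edge a b c ↔ G.Edge b a c from ⟨Edge.swap₁₂, Edge.swap₁₂⟩]

theorem edgeCoeff_swap₂₃ (a b c : V) : G.edgeCoeff a b c = G.edgeCoeff a c b := by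
  unfold edgeCoeff
  rw [show G.Edge a b c ↔ G.Edge a c b from ⟨Edge.swap₂₃, Edge.swap₂₃⟩]

theorem edgeCoeff_self (a c : V) : G.edgeCoeff a a c = 0 :=
  if_neg fun h => h.ne rfl

theorem edgeCoeff_nonneg (a b c : V) : 0 ≤ G.edgeCoeff a b c := by
  unfold edgeCoeff; split_ifs <;> norm_num

theorem shift_mem_stdSimplex [Fintype V] [DecidableEq V] {x : V → ℝ} (hx : x ∈ stdSimplex ℝ V)
    {i j : V} {t : ℝ} (hi : -x i ≤ t) (hj : t ≤ x j) (hij : i ≠ j) :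
    x + t • (Pi.single i 1 - Pi.single j 1) ∈ stdSimplex ℝ V := by
  refine ⟨fun v => ?_, ?_⟩
  · have := hx.1 v
    by_cases hv : v = i
    · subst hv
      simp [hij]
      linarith
    · by_cases hv' : v = j
      · subst hv'
        simp [hv]
        linarith
      · simpa [hv, hv'] using this
  · simp [Finset.sum_add_distrib, ← Finset.mul_sum, Finset.sum_sub_distrib, hx.2]

/-! ### Optimal weightings of minimal support -/

/-- There is an optimal weighting for which all pairs of vertices in the support are covered by
edges in the support, and all links in the support have the same weight. -/
theorem exists_optimal [Fintype V] [Nonempty V] (G : UniformGraph 3 V) :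
    ∃ x ∈ stdSimplex ℝ V, G.lagrangianFun x = G.lagrangian ∧
      (∀ i j, i ≠ j → 0 < x i → 0 < x j → ∃ k, 0 < x k ∧ G.Edge i j k) ∧
      ∀ i, 0 < x i → ∑ b, ∑ c, G.edgeCoeff i b c * (x b * x c) = 6 * G.lagrangian := by
  classical
  obtain ⟨⟨x₀, hx₀, hx₀'⟩, hub⟩ := G.isGreatest_lagrangian
  have hex : ∃ n, ∃ x ∈ stdSimplex ℝ V, G.lagrangianFun x = G.lagrangian ∧
      (Finset.univ.filter fun v => 0 < x v).card = n := ⟨_, x₀, hx₀, hx₀', rfl⟩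
  obtain ⟨x, hx, hopt, hn⟩ := Nat.find_spec hex
  have hmin : ∀ y ∈ stdSimplex ℝ V, G.lagrangianFun y = G.lagrangian →
      (Finset.univ.filter fun v => 0 < x v).card ≤ (Finset.univ.filter fun v => 0 < y v).card :=
    fun y hy hy' => hn ▸ Nat.find_min' hex ⟨y, hy, hy', rfl⟩
  have hle : ∀ y ∈ stdSimplex ℝ V, trilinearForm G.edgeCoeff y y y ≤ 6 * G.lagrangian := by
    intro y hy
    rw [← six_mul_lagrangianFun]
    have := hub ⟨y, hy, rfl⟩
    linarith
  have hxQ : trilinearForm G.edgeCoeff x x x = 6 * G.lagrangian := by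
    rw [← six_mul_lagrangianFun, hopt]
  set l : V → ℝ := fun i => ∑ b, ∑ c, G.edgeCoeff i b c * (x b * x c) with hl
  have hshift : ∀ i j t, trilinearForm G.edgeCoeff (x + t • (Pi.single i 1 - Pi.single j 1))
      (x + t • (Pi.single i 1 - Pi.single j 1)) (x + t • (Pi.single i 1 - Pi.single j 1)) =
      6 * G.lagrangian + 3 * t * (l i - l j) - 6 * t ^ 2 * ∑ c, G.edgeCoeff i j c * x c :=
    fun i j t => by
      rw [trilinearForm_shift edgeCoeff_swap₁₂ edgeCoeff_swap₂₃ edgeCoeff_self, hxQ]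
  have hlle : ∀ i j, i ≠ j → 0 < x i → 0 < x j → l i ≤ l j := by
    intro i j hij hi hj
    by_contra! hlt
    set P := ∑ c, G.edgeCoeff i j c * x c with hP
    have hP0 : 0 ≤ P := Finset.sum_nonneg fun c _ => mul_nonneg (edgeCoeff_nonneg _ _ _) (hx.1 c)
    have hδ : 0 < l i - l j := by linarith
    -- So small a step keeps the quadratic loss `6 * t ^ 2 * P` below the linear gain `3 * t * (l i
    -- - l j)`.
    set t := min (x j) ((l i - l j) / (4 * (P + 1))) with ht
    have ht0 : 0 < t := lt_min hj (by positivity)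
    have htP : t * (4 * (P + 1)) ≤ l i - l j := by
      rw [← le_div_iff₀ (by positivity)]
      exact min_le_right _ _
    have := hle _ (shift_mem_stdSimplex hx (by linarith) (min_le_left _ _ : t ≤ x j) hij)
    rw [hshift] at this
    have h2 : 6 * t ^ 2 * P = t * (6 * t * P) := by ring
    have h3 : 0 < t * (3 * (l i - l j) - 6 * t * P) := by
      apply mul_pos ht0
      nlinarith
    linarith
  have hleq : ∀ i j, 0 < x i → 0 < x j → l i = l j := fun i j hi hj => by
    by_cases hij : i = j
    · rw [hij]
    · exact le_antisymm (hlle i j hij hi hj) (hlle j i (Ne.symm hij) hj hi)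
  refine ⟨x, hx, hopt, ?_, ?_⟩
  · intro i j hij hi hj
    by_contra! hno
    have hP : ∑ c, G.edgeCoeff i j c * x c = 0 := by
      refine Finset.sum_eq_zero fun c _ => ?_
      by_cases hc : 0 < x c
      · rw [edgeCoeff, if_neg (hno c hc), zero_mul]
      · rw [le_antisymm (not_lt.1 hc) (hx.1 c), mul_zero]
    -- For an uncovered pair both the linear and the quadratic term vanish, so moving all weight of
    -- `j` to `i` stays optimal and shrinks the support.
    have hmem := shift_mem_stdSimplex hx (by linarith : -x i ≤ x j) le_rfl hij
    have hval := hshift i j (x j)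
    rw [hP, hleq i j hi hj, ← six_mul_lagrangianFun] at hval
    have hcard := hmin _ hmem (by linarith)
    refine absurd hcard (not_le.2 (Finset.card_lt_card ?_))
    rw [Finset.ssubset_iff_of_subset]
    · exact ⟨j, by simpa using hj, by simp [hij.symm]⟩
    · intro v hv
      simp only [Finset.mem_filter, Finset.mem_univ, true_and] at hv ⊢
      by_cases hvi : v = i
      · rwa [hvi]
      · by_cases hvj : v = j
        · rwa [hvj]
        · simpa [hvi, hvj] using hv
  · intro i hi
    have hsum : trilinearForm G.edgeCoeff x x x = ∑ a, x a * l a := by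
      unfold trilinearForm
      refine Finset.sum_congr rfl fun a _ => ?_
      simp only [hl, Finset.mul_sum]
      refine Finset.sum_congr rfl fun b _ => Finset.sum_congr rfl fun c _ => ?_
      ring
    have : ∑ a, x a * l a = ∑ a, x a * l i := by
      refine Finset.sum_congr rfl fun a _ => ?_
      by_cases ha : 0 < x a
      · rw [hleq a i ha hi]
      · rw [le_antisymm (not_lt.1 ha) (hx.1 a), zero_mul, zero_mul]
    rw [← Finset.sum_mul, hx.2, one_mul] at this
    change l i = _
    rw [← this, ← hsum, hxQ]

/-! ### Small supports and the conclusion -/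

/-- The sum over all triples of distinct vertices in terms of power sums. -/
theorem sum_distinct_eq {W : Type*} [Fintype W] [DecidableEq W] {x : W → ℝ}
    (hsum : ∑ v, x v = 1) :
    ∑ a, ∑ b, ∑ c, (if a ≠ b ∧ a ≠ c ∧ b ≠ c then x a * x b * x c else 0) =
      1 + ∑ v, (2 * x v ^ 3 - 3 * x v ^ 2) := by
  have hpt : ∀ a b c, (if a ≠ b ∧ a ≠ c ∧ b ≠ c then x a * x b * x c else 0) =
      x a * x b * x c - (if a = b then x a * x b * x c else 0)
        - (if a = c then x a * x b * x c else 0) - (if b = c then x a * x b * x c else 0)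
        + 2 * (if a = b then (if b = c then x a * x b * x c else 0) else 0) := by
    intro a b c
    by_cases h1 : a = b <;> by_cases h2 : b = c <;> by_cases h3 : a = c <;> simp_all
    ring
  simp only [hpt, Finset.sum_add_distrib, Finset.sum_sub_distrib, ← Finset.mul_sum]
  have e0 : ∑ a, ∑ b, x a * x b * ∑ c, x c = 1 := by
    simp [← Finset.mul_sum, hsum]
  have e1 : ∑ a, ∑ b, ∑ c, (if a = b then x a * x b * x c else 0) = ∑ v, x v ^ 2 := by
    refine Finset.sum_congr rfl fun a _ => ?_
    rw [Finset.sum_eq_single a]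
    · simp [← Finset.mul_sum, hsum, sq]
    · intro b _ hb; simp [hb.symm]
    · simp
  have e2 : ∑ a, ∑ b, ∑ c, (if a = c then x a * x b * x c else 0) = ∑ v, x v ^ 2 := by
    refine Finset.sum_congr rfl fun a _ => ?_
    simp only [Finset.sum_ite_eq, Finset.mem_univ, if_true, ← Finset.sum_mul, ← Finset.mul_sum,
      hsum, mul_one, sq]
  have e3 : ∑ a, ∑ b, ∑ c, (if b = c then x a * x b * x c else 0) = ∑ v, x v ^ 2 := by
    simp only [Finset.sum_ite_eq, Finset.mem_univ, if_true, mul_assoc, ← Finset.mul_sum,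
      ← Finset.sum_mul, hsum, one_mul, sq]
  have e4 : ∑ a, ∑ b, ∑ c, (if a = b then (if b = c then x a * x b * x c else 0) else 0) =
      ∑ v, x v ^ 3 := by
    refine Finset.sum_congr rfl fun a _ => ?_
    rw [Finset.sum_eq_single a]
    · simp [pow_three, mul_assoc]
    · intro b _ hb; simp [hb.symm]
    · simp
  rw [e0, e1, e2, e3, e4]
  ring

/-- Tangent line to `2 * t ^ 3 - 3 * t ^ 2` at the uniform weight 1/5; the gap is `(t - 1/5) ^ 2 *
(11/5 - 2 * t)`. Five vertices give 12/25, six times 2/25. -/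
theorem sum_distinct_le {W : Type*} [Fintype W] [DecidableEq W] {x : W → ℝ} (hx : ∀ v, 0 ≤ x v)
    (hsum : ∑ v, x v = 1) :
    ∑ a, ∑ b, ∑ c, (if a ≠ b ∧ a ≠ c ∧ b ≠ c then x a * x b * x c else 0) ≤
      1 / 25 + 11 / 125 * Fintype.card W := by
  rw [sum_distinct_eq hsum]
  have hx1 : ∀ v, x v ≤ 1 := fun v => by
    rw [← hsum]
    exact Finset.single_le_sum (fun i _ => hx i) (Finset.mem_univ v)
  have : ∑ v, (2 * x v ^ 3 - 3 * x v ^ 2) ≤ ∑ v, (11 / 125 - 24 / 25 * x v) := by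
    refine Finset.sum_le_sum fun v _ => ?_
    nlinarith [mul_nonneg (sq_nonneg (x v - 1 / 5)) (by linarith [hx1 v] : 0 ≤ 11 / 10 - x v)]
  rw [Finset.sum_sub_distrib (fun _ => (11 / 125 : ℝ)), ← Finset.mul_sum _ x, hsum] at this
  simp only [Finset.sum_const, Finset.card_univ, nsmul_eq_mul] at this
  linarith

theorem sum_support_eq [Fintype V] {x : V → ℝ} [Fintype {v // 0 < x v}] (F : V → ℝ)
    (hF : ∀ v, ¬ 0 < x v → F v = 0) : ∑ w : {v // 0 < x v}, F w = ∑ v, F v := by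
  classical
  rw [← Finset.sum_subtype (Finset.univ.filter fun v => 0 < x v) (by simp) F, Finset.sum_filter]
  refine Finset.sum_congr rfl fun v _ => ?_
  split_ifs with h
  · rfl
  · exact (hF v h).symm

theorem coveringTriangleFree_support (hG : G.Free linearTriangle) {x : V → ℝ}
    (hcov : ∀ i j, i ≠ j → 0 < x i → 0 < x j → ∃ k, 0 < x k ∧ G.Edge i j k) :
    CoveringTriangleFree fun a b c : {v // 0 < x v} => G.Edge a b c where
  swap₁₂ := Edge.swap₁₂
  swap₂₃ := Edge.swap₂₃
  ne := fun hT h => hT.ne (congrArg _ h)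
  cover := fun {a b} hab => by
    obtain ⟨k, hk, hE⟩ := hcov a b (fun h => hab (Subtype.ext h)) a.2 b.2
    exact ⟨⟨k, hk⟩, hE⟩
  free := by
    classical
    rintro ⟨a, _⟩ ⟨b, _⟩ ⟨c, _⟩ ⟨p, _⟩ ⟨q, _⟩ ⟨r, _⟩ hp hq hr h1 h2 h3 h4 h5 h6
    simp only [ne_eq, Subtype.mk.injEq] at *
    -- The corners `a`, `b`, `c` take the even positions, where two edges of `linearTriangle` meet.
    have hinj : Function.Injective ![a, p, b, q, c, r] := by
      have := hp.ne
      have := hp.ne₁₃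
      have := hp.ne₂₃
      have := hq.ne
      have := hq.ne₁₃
      have := hq.ne₂₃
      have := hr.ne
      have := hr.ne₁₃
      have := hr.ne₂₃
      intro i j hij
      fin_cases i <;> fin_cases j <;> simp at hij ⊢ <;> grind
    refine hG ⟨⟨_, hinj⟩, ?_⟩
    have hp := hp.swap₂₃
    have hq := hq.swap₂₃
    have hr := hr.swap₂₃
    rw [edge_iff] at hp hq hr
    intro e he
    simp only [linearTriangle, Finset.mem_insert, Finset.mem_singleton] at he
    rcases he with rfl | rfl | rfl
    · convert hp using 1
      simp [Finset.map_insert]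
    · convert hq using 1
      simp [Finset.map_insert]
    · convert hr using 1
      simp [Finset.map_insert]

theorem contains_complete_of_le [Fintype V] [Nonempty V] (hG : G.Free linearTriangle)
    (hle : 2 / 25 ≤ G.lagrangian) :
    G.lagrangian ≤ 2 / 25 ∧ G.Contains (complete 3 5) := by
  classical
  obtain ⟨x, hx, hopt, hcov, hlink⟩ := G.exists_optimal
  have h := coveringTriangleFree_support hG hcov
  have hsupp : ∀ v, ¬ 0 < x v → x v = 0 := fun v hv => le_antisymm (not_lt.1 hv) (hx.1 v)
  have hsum : ∑ w : {v // 0 < x v}, x w = 1 := by rw [sum_support_eq x hsupp, hx.2]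
  have hcard : Fintype.card {v // 0 < x v} ≤ 5 := by
    by_contra! hc
    obtain ⟨a, ha⟩ := h.exists_linkWeight_lt (x := fun w => x w) hc (fun w => w.2.le) hsum
    have : CoveringTriangleFree.linkWeight (fun a b c : {v // 0 < x v} => G.Edge a b c)
        (fun w => x w) a = 6 * G.lagrangian := by
      rw [← hlink a a.2, ← sum_support_eq (x := x)]
      · refine Finset.sum_congr rfl fun b _ => ?_
        rw [← sum_support_eq (x := x)]
        · refine Finset.sum_congr rfl fun c _ => ?_
          simp [edgeCoeff]
        · intro v hv; simp [hsupp v hv]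
      · intro v hv; simp [hsupp v hv]
    linarith
  have hQ : 6 * G.lagrangian = ∑ a : {v // 0 < x v}, ∑ b : {v // 0 < x v}, ∑ c : {v // 0 < x v},
      (if G.Edge a b c then x a * x b * x c else 0) := by
    rw [← hopt, six_mul_lagrangianFun, trilinearForm, ← sum_support_eq (x := x)]
    · refine Finset.sum_congr rfl fun a _ => ?_
      rw [← sum_support_eq (x := x)]
      · refine Finset.sum_congr rfl fun b _ => ?_
        rw [← sum_support_eq (x := x)]
        · refine Finset.sum_congr rfl fun c _ => ?_
          simp [edgeCoeff]
        · intro v hv; simp [hsupp v hv]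
      · intro v hv; simp [hsupp v hv]
    · intro v hv; simp [hsupp v hv]
  have hD := sum_distinct_le (x := fun w : {v // 0 < x v} => x w) (fun w => w.2.le) hsum
  simp only [← Fintype.sum_prod_type'] at hQ hD
  have hterm : ∀ t : {v // 0 < x v} × {v // 0 < x v} × {v // 0 < x v},
      (if G.Edge t.1 t.2.1 t.2.2 then x t.1 * x t.2.1 * x t.2.2 else 0) ≤
      if t.1 ≠ t.2.1 ∧ t.1 ≠ t.2.2 ∧ t.2.1 ≠ t.2.2 then x t.1 * x t.2.1 * x t.2.2 else 0 := by
    rintro ⟨a, b, c⟩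
    have hpos : 0 < x a * x b * x c := mul_pos (mul_pos a.2 b.2) c.2
    by_cases hE : G.Edge a b c
    · have hdist : a ≠ b ∧ a ≠ c ∧ b ≠ c := ⟨h.ne hE, h.ne₁₃ hE, h.ne₂₃ hE⟩
      simp only [if_pos hE, if_pos hdist, le_refl]
    · simp only [if_neg hE]
      split_ifs <;> [exact hpos.le; exact le_rfl]
  have hQD := Finset.sum_le_sum fun t (_ : t ∈ Finset.univ) => hterm t
  have hcard' : (Fintype.card {v // 0 < x v} : ℝ) ≤ 5 := by exact_mod_cast hcard
  have hcard5 : Fintype.card {v // 0 < x v} = 5 := by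
    refine le_antisymm hcard ?_
    -- Four vertices would allow only 49/125, less than 12/25.
    by_contra! hc
    have : (Fintype.card {v // 0 < x v} : ℝ) ≤ 4 := by exact_mod_cast Nat.le_of_lt_succ hc
    linarith
  have hle' : G.lagrangian ≤ 2 / 25 := by linarith
  refine ⟨hle', ?_⟩
  have hall : ∀ a b c : {v // 0 < x v}, a ≠ b → a ≠ c → b ≠ c → G.Edge a b c := by
    intro a b c h1 h2 h3
    by_contra hE
    -- All weights on the support are positive, so a single missing triple makes the comparison
    -- strict.
    have hlt := Finset.sum_lt_sum (fun t (_ : t ∈ Finset.univ) => hterm t)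
      ⟨(a, b, c), Finset.mem_univ _, by
        simpa [hE, h1, h2, h3] using mul_pos (mul_pos a.2 b.2) c.2⟩
    linarith
  let f := (Fintype.equivFinOfCardEq hcard5).symm
  refine ⟨f.toEmbedding.trans (Function.Embedding.subtype _), fun e he => ?_⟩
  obtain ⟨i, j, k, hij, hik, hjk, rfl⟩ :=
    Finset.card_eq_three.1 (Finset.mem_powersetCard.1 he).2
  have hE := hall (f i) (f j) (f k) (by simpa) (by simpa) (by simpa)
  rw [edge_iff] at hE
  convert hE using 1
  simp [Finset.map_insert]

/-- Give weight 1/5 to each vertex of the copy: its ten edges contribute 1/125 each. -/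
theorem le_lagrangian_of_contains [Fintype V] (hG : G.Contains (complete 3 5)) :
    2 / 25 ≤ G.lagrangian := by
  classical
  obtain ⟨f, hf⟩ := hG
  have : Nonempty V := ⟨f 0⟩
  set x : V → ℝ := fun v => if v ∈ Finset.univ.map f then 1 / 5 else 0 with hx
  have hmem : x ∈ stdSimplex ℝ V := by
    refine ⟨fun v => ?_, ?_⟩
    · simp only [hx]; split_ifs <;> norm_num
    · simp only [hx]
      rw [← Finset.sum_filter, Finset.filter_mem_eq_inter, Finset.univ_inter]
      simp
  refine le_trans ?_ (G.isGreatest_lagrangian.2 ⟨x, hmem, rfl⟩)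
  have hsub : (complete 3 5).edges.map (Finset.mapEmbedding f).toEmbedding ⊆ G.edges := by
    intro e he
    obtain ⟨e', he', rfl⟩ := Finset.mem_map.1 he
    exact hf e' he'
  refine le_trans ?_ (Finset.sum_le_sum_of_subset_of_nonneg hsub
    fun e _ _ => Finset.prod_nonneg fun i _ => hmem.1 i)
  rw [Finset.sum_map]
  have : ∀ e ∈ (complete 3 5).edges,
      ∏ i ∈ (Finset.mapEmbedding f).toEmbedding e, x i = (1 / 5 : ℝ) ^ 3 := by
    intro e he
    change ∏ i ∈ e.map f, x i = _
    have hxf : ∀ i ∈ e, x (f i) = 1 / 5 := fun i _ => by simp [hx]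
    rw [Finset.prod_map, Finset.prod_congr rfl hxf, Finset.prod_const, (complete 3 5).card_eq e he]
  rw [Finset.sum_congr rfl this, Finset.sum_const, complete, Finset.card_powersetCard]
  simp [Nat.choose]
  norm_num

/-- The simplex is empty here, and `sSup ∅` is 0 by default. -/
theorem lagrangian_of_isEmpty [Fintype V] [IsEmpty V] : G.lagrangian = 0 := by
  have : stdSimplex ℝ V = ∅ := by
    ext x
    simp [stdSimplex]
  rw [lagrangian, this, Set.image_empty, Real.sSup_empty]

theorem lagrangian_le [Fintype V] (hG : G.Free linearTriangle) : G.lagrangian ≤ 2 / 25 := by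
  rcases isEmpty_or_nonempty V with hV | hV
  · rw [lagrangian_of_isEmpty]
    norm_num
  · by_contra! h
    exact absurd (contains_complete_of_le hG h.le).1 (not_le.2 h)

/-- The upper bound is an instance of `lagrangian_le`, as the six vertices of the linear triangle do
not embed into five. -/
theorem lagrangian_complete_three_five : (complete 3 5).lagrangian = 2 / 25 := by
  refine le_antisymm (lagrangian_le fun ⟨f, _⟩ => ?_) (le_lagrangian_of_contains
    ⟨Function.Embedding.refl _, fun e he => by simpa using he⟩)
  simpa using Fintype.card_le_of_embedding f

end UniformGraph

theorem theorem1p6 {V : Type*} [Fintype V] (G : UniformGraph 3 V)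
    (hG : G.Free UniformGraph.linearTriangle) :
    G.lagrangian ≤ (UniformGraph.complete 3 5).lagrangian ∧
      (UniformGraph.complete 3 5).lagrangian = 2 / 25 ∧
      (G.lagrangian = (UniformGraph.complete 3 5).lagrangian ↔
        G.Contains (UniformGraph.complete 3 5)) := by
  rw [UniformGraph.lagrangian_complete_three_five]
  refine ⟨UniformGraph.lagrangian_le hG, rfl, fun h => ?_, fun h =>
    le_antisymm (UniformGraph.lagrangian_le hG) (UniformGraph.le_lagrangian_of_contains h)⟩
  rcases isEmpty_or_nonempty V with hV | hV
  · rw [UniformGraph.lagrangian_of_isEmpty] at h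
    norm_num at h
  · exact (UniformGraph.contains_complete_of_le hG h.ge).2
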